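/- Let $S=\Bbbk[x_1,\ldots,x_n]$ be a polynomial ring over a field $\Bbbk$. For an ideal $J\subseteq S$, the dual graph $G(J)$ is the simple graph whose vertices are the minimal primes of $J$, where two distinct minimal primes $\mathfrak{p},\mathfrak{q}$ form an edge if and only if $\operatorname{height}(\mathfrak{p}+\mathfrak{q})=\operatorname{height}(J)+1$ (with $\operatorname{height}(S)=\infty$). The diameter $\operatorname{diam}(J)\in\mathbb{N}\cup\{\infty\}$ is the diameter of $G(J)$, i.e. the supremum of the distances between two vertices, where the distance is the least length of a path joining them, and $\infty$ if there is none (the diameter of the empty graph, i.e. the case $J=S$, is $0$). For a term order $\prec$ on $S$, $\mathrm{in}_{\prec}J$ denotes the ideal generated by the leading terms of the elements of $J$. Let $I\subseteq S$ be a radical ideal with (irredundant) primary decomposition $I=\mathfrak{p}_1\cap\cdots\cap\mathfrak{p}_s$, where $\mathfrak{p}_1,\ldots,\mathfrak{p}_s$ are prime ideals, and let $\prec$ be a term order on $S$. If $\mathrm{in}_{\prec}\big(\bigcap_{i\in A}\mathfrak{p}_i\big)$ is radical for every subset $A\subseteq\{1,\ldots,s\}$, then $$\operatorname{diam}(I)\leq\operatorname{diam}(\mathrm{in}_{\prec}I).$$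 -/

import Mathlib

/-- The initial ideal of `I` with respect to a monomial order `m`: the ideal generated by the
leading terms of the elements of `I` (the leading term of `0` is `0`). -/
noncomputable def MonomialOrder.initialIdeal {σ : Type*} (m : MonomialOrder σ)
    {R : Type*} [CommRing R] (I : Ideal (MvPolynomial σ R)) : Ideal (MvPolynomial σ R) :=
  Ideal.span {t | ∃ f ∈ I, t = m.leadingTerm f}

/-- The dual graph of an ideal `I`: its vertices are the minimal primes of `I`, and two distinct
minimal primes `p`, `q` are adjacent when `height (p + q) = height I + 1`.  The unit ideal has
height `⊤`, so comaximal minimal primes are never adjacent when `I` has finite height. -/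
def Ideal.dualGraph {R : Type*} [CommRing R] (I : Ideal R) : SimpleGraph I.minimalPrimes where
  Adj p q := p ≠ q ∧ ((p : Ideal R) ⊔ (q : Ideal R)).height = I.height + 1
  symm := ⟨fun p q h => ⟨h.1.symm, by rw [sup_comm]; exact h.2⟩⟩
  loopless := ⟨fun _ h => h.1 rfl⟩

/-- The diameter of an ideal: the diameter of its dual graph, the supremum of the distances between
two vertices, which is `⊤` when the dual graph is disconnected. -/
noncomputable def Ideal.diam {R : Type*} [CommRing R] (I : Ideal R) : ℕ∞ :=
  I.dualGraph.ediam

/-! Each minimal prime P of in I contains some in p_i, because in I contains the product of the in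
p_i. Choosing such an i gives a map φ from the vertices of G(in I) to those of G(I). It suffices
that φ is surjective and sends each edge to an edge or to a single vertex.

Surjectivity: if p_i is missed, every P contains in(⋂_{j≠i} p_j), so in I, being radical, contains
it too. Nested ideals with the same initial ideal coincide (`eq_of_le_of_initialIdeal_le`), which
contradicts irredundancy.

Edges: if P, Q are adjacent and go to i ≠ j, then in p_i + in p_j ⊆ P + Q has height at most ht I +
1. Radicality of in(p_i ∩ p_j) makes in commute with this intersection, hence with the sum
(`initialIdeal_sup_le`). As in preserves height (`height_initialIdeal`), ht(p_i + p_j) ≤ ht I + 1,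
and irredundancy gives the reverse inequality.

Height invariance uses sets of variables independent modulo an ideal, and a count of standard
monomials. The order need not refine total degree, so the count rests on a linear bound for degree
growth under reduction (`exists_degree_le_mul_degree`). -/

open MvPolynomial

/-! ### Initial ideals of products, intersections and sums -/

namespace MonomialOrder

open scoped MonomialOrder

variable {σ 𝕜 : Type*} [Field 𝕜] (m : MonomialOrder σ)

/-- The exponents of the leading monomials of the nonzero elements of `I`. -/
def leadingExponents (I : Ideal (MvPolynomial σ 𝕜)) : Set (σ →₀ ℕ) :=
  {a | ∃ g ∈ I, g ≠ 0 ∧ m.degree g = a}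

variable {m} {I J : Ideal (MvPolynomial σ 𝕜)}

theorem add_mem_leadingExponents {a : σ →₀ ℕ} (ha : a ∈ m.leadingExponents I) (b : σ →₀ ℕ) :
    b + a ∈ m.leadingExponents I := by
  classical
  obtain ⟨g, hg, hg0, rfl⟩ := ha
  have hb : (monomial b (1 : 𝕜)) ≠ 0 := by simp
  refine ⟨monomial b 1 * g, I.mul_mem_left _ hg, mul_ne_zero hb hg0, ?_⟩
  rw [m.degree_mul hb hg0, m.degree_monomial, if_neg one_ne_zero]

theorem initialIdeal_eq_span : m.initialIdeal I =
    Ideal.span ((fun a ↦ monomial a (1 : 𝕜)) '' m.leadingExponents I) := by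
  apply le_antisymm
  · refine Ideal.span_le.2 ?_
    rintro _ ⟨f, hf, rfl⟩
    by_cases h0 : f = 0
    · simp [h0, leadingTerm]
    rw [← C_mul_leadingCoeff_monomial_degree]
    exact Ideal.mul_mem_left _ _ (Ideal.subset_span ⟨_, ⟨f, hf, h0, rfl⟩, rfl⟩)
  · refine Ideal.span_le.2 ?_
    rintro _ ⟨_, ⟨f, hf, h0, rfl⟩, rfl⟩
    have h1 : m.leadingTerm f ∈ m.initialIdeal I := Ideal.subset_span ⟨f, hf, rfl⟩
    have h2 := Ideal.mul_mem_left _ (C (m.leadingCoeff f)⁻¹) h1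
    rw [← C_mul_leadingCoeff_monomial_degree, ← mul_assoc, ← C_mul,
      inv_mul_cancel₀ (m.leadingCoeff_ne_zero_iff.2 h0), C_1, one_mul] at h2
    exact h2

theorem mem_initialIdeal {f : MvPolynomial σ 𝕜} :
    f ∈ m.initialIdeal I ↔ ∀ a ∈ f.support, a ∈ m.leadingExponents I := by
  rw [initialIdeal_eq_span, mem_ideal_span_monomial_image]
  refine forall₂_congr fun a _ ↦ ⟨?_, fun h ↦ ⟨a, h, le_rfl⟩⟩
  rintro ⟨b, hb, hba⟩
  rw [← tsub_add_cancel_of_le hba]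
  exact add_mem_leadingExponents hb _

theorem monomial_mem_initialIdeal {a : σ →₀ ℕ} :
    monomial a (1 : 𝕜) ∈ m.initialIdeal I ↔ a ∈ m.leadingExponents I := by
  classical
  simp [mem_initialIdeal, support_monomial]

theorem leadingExponents_subset_iff :
    m.leadingExponents I ⊆ m.leadingExponents J ↔ m.initialIdeal I ≤ m.initialIdeal J := by
  refine ⟨fun h f hf ↦ mem_initialIdeal.2 fun a ha ↦ h (mem_initialIdeal.1 hf a ha),
    fun h a ha ↦ ?_⟩
  exact monomial_mem_initialIdeal.1 (h (monomial_mem_initialIdeal.2 ha))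

theorem initialIdeal_mono (h : I ≤ J) : m.initialIdeal I ≤ m.initialIdeal J :=
  Ideal.span_mono fun _ ⟨f, hf, e⟩ ↦ ⟨f, h hf, e⟩

theorem initialIdeal_mul_le :
    m.initialIdeal I * m.initialIdeal J ≤ m.initialIdeal (I * J) := by
  rw [initialIdeal, initialIdeal, Ideal.span_mul_span', Ideal.span_le]
  rintro _ ⟨_, ⟨f, hf, rfl⟩, _, ⟨g, hg, rfl⟩, rfl⟩
  refine Ideal.subset_span ⟨f * g, Ideal.mul_mem_mul hf hg, ?_⟩
  by_cases hf0 : f = 0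
  · simp [hf0, leadingTerm]
  by_cases hg0 : g = 0
  · simp [hg0, leadingTerm]
  simp [leadingTerm, monomial_mul, m.degree_mul hf0 hg0]

theorem degree_sub_C_mul_lt {f g : MvPolynomial σ 𝕜} (hg : g ≠ 0)
    (h : m.degree g = m.degree f) (h0 : m.degree f ≠ 0) :
    m.degree (f - C (m.leadingCoeff f / m.leadingCoeff g) * g) ≺[m] m.degree f := by
  have hlg := m.leadingCoeff_ne_zero_iff.2 hg
  set c := m.leadingCoeff f / m.leadingCoeff g
  have hle : m.degree (f - C c * g) ≼[m] m.degree f := by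
    refine m.degree_sub_le.trans (sup_le le_rfl ?_)
    rw [← smul_eq_C_mul, ← h]
    exact m.degree_smul_le
  refine lt_of_le_of_ne hle fun he ↦ ?_
  have he := m.toSyn.injective he
  have hne : f - C c * g ≠ 0 := by
    intro h1
    rw [h1, m.degree_zero] at he
    exact h0 he.symm
  refine m.coeff_degree_ne_zero_iff.2 hne ?_
  rw [he, coeff_sub, coeff_C_mul, ← h]
  have : coeff (m.degree g) f = m.leadingCoeff f := by rw [h]; rfl
  rw [this]
  change _ - c * m.leadingCoeff g = 0
  simp [c, hlg]

/-- Nested ideals with the same initial ideal are equal. -/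
theorem eq_of_le_of_initialIdeal_le (h : I ≤ J) (h' : m.initialIdeal J ≤ m.initialIdeal I) :
    I = J := by
  refine le_antisymm h ?_
  have key : ∀ (s : m.syn) (f : MvPolynomial σ 𝕜), f ∈ J → m.toSyn (m.degree f) = s → f ∈ I := by
    intro s
    induction s using WellFoundedLT.induction with
    | ind s ih =>
      rintro f hf rfl
      by_cases hf0 : f = 0
      · simp [hf0]
      obtain ⟨g, hg, hg0, e⟩ := leadingExponents_subset_iff.2 h' ⟨f, hf, hf0, rfl⟩
      -- Cancelling leading terms cannot lower degree 0, since zero also has degree 0; but here `I`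
      -- contains a nonzero constant.
      by_cases hd : m.degree f = 0
      · rw [hd] at e
        rw [m.eq_C_of_degree_eq_zero e] at hg
        rw [Ideal.eq_top_of_isUnit_mem _ hg
          ((isUnit_iff_ne_zero.2 (m.leadingCoeff_ne_zero_iff.2 hg0)).map C)]
        trivial
      have h1 := ih _ (degree_sub_C_mul_lt hg0 e hd) _
        (J.sub_mem hf (J.mul_mem_left _ (h hg))) rfl
      have h2 := I.add_mem h1 (I.mul_mem_left (C (m.leadingCoeff f / m.leadingCoeff g)) hg)
      simpa using h2
  exact fun f hf ↦ key _ f hf rfl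

/-- Only cancellation of leading terms is a problem. Then the common leading exponent is attained by
some w in I ∩ J, and moving a multiple of w from f to g keeps the sum while lowering both degrees.
-/
theorem degree_add_mem_leadingExponents
    (h : m.initialIdeal I ⊓ m.initialIdeal J ≤ m.initialIdeal (I ⊓ J))
    {f g : MvPolynomial σ 𝕜} (hf : f ∈ I) (hg : g ∈ J) (hfg : f + g ≠ 0) :
    m.degree (f + g) ∈ m.leadingExponents I ∪ m.leadingExponents J := by
  suffices key : ∀ (s : m.syn) (f g : MvPolynomial σ 𝕜), f ∈ I → g ∈ J → f + g ≠ 0 →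
      m.toSyn (m.degree f) ⊔ m.toSyn (m.degree g) = s →
      m.degree (f + g) ∈ m.leadingExponents I ∪ m.leadingExponents J from key _ f g hf hg hfg rfl
  clear! f g
  intro s
  induction s using WellFoundedLT.induction with
  | ind s ih =>
    rintro f g hf hg hfg rfl
    by_cases hf0 : f = 0
    · subst hf0
      rw [zero_add] at hfg ⊢
      exact Or.inr ⟨g, hg, hfg, rfl⟩
    by_cases hg0 : g = 0
    · subst hg0
      rw [add_zero] at hfg ⊢
      exact Or.inl ⟨f, hf, hfg, rfl⟩
    rcases lt_trichotomy (m.toSyn (m.degree f)) (m.toSyn (m.degree g)) with hlt | heq | hlt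
    · rw [m.degree_add_eq_right_of_lt hlt]
      exact Or.inr ⟨g, hg, hg0, rfl⟩
    · have heq' := m.toSyn.injective heq
      by_cases hd : m.degree (f + g) = m.degree f
      · rw [hd]
        exact Or.inl ⟨f, hf, hf0, rfl⟩
      have hle : m.degree (f + g) ≼[m] m.degree f := by
        simpa [heq] using m.degree_add_le (f := f) (g := g)
      have hlt : m.degree (f + g) ≺[m] m.degree f :=
        lt_of_le_of_ne hle fun e ↦ hd (m.toSyn.injective e)
      have hd0 : m.degree f ≠ 0 := by
        intro e
        rw [e] at hlt
        simp only [map_zero] at hlt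
        exact not_lt_bot hlt
      have hmem : m.degree f ∈ m.leadingExponents (I ⊓ J) :=
        monomial_mem_initialIdeal.1 (h ⟨monomial_mem_initialIdeal.2 ⟨f, hf, hf0, rfl⟩,
          monomial_mem_initialIdeal.2 ⟨g, hg, hg0, heq'.symm⟩⟩)
      obtain ⟨w, ⟨hwI, hwJ⟩, hw0, hw⟩ := hmem
      set c := m.leadingCoeff f / m.leadingCoeff w
      have h1 := degree_sub_C_mul_lt hw0 hw hd0
      have hsum : (f - C c * w) + (g + C c * w) = f + g := by ring
      have h2 : m.degree (g + C c * w) ≺[m] m.degree f := by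
        have e : g + C c * w = (f + g) - (f - C c * w) := by ring
        rw [e]
        exact m.degree_sub_le.trans_lt (max_lt hlt h1)
      have := ih _ (max_lt h1 h2 |>.trans_le le_sup_left) (f - C c * w) (g + C c * w)
        (I.sub_mem hf (I.mul_mem_left _ hwI)) (J.add_mem hg (J.mul_mem_left _ hwJ))
        (by rwa [hsum]) rfl
      rwa [hsum] at this
    · rw [m.degree_add_of_lt hlt]
      exact Or.inl ⟨f, hf, hf0, rfl⟩

/-- If taking initial ideals commutes with the intersection of two ideals, then it also commutes
with their sum. -/
theorem initialIdeal_sup_le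
    (h : m.initialIdeal I ⊓ m.initialIdeal J ≤ m.initialIdeal (I ⊓ J)) :
    m.initialIdeal (I ⊔ J) ≤ m.initialIdeal I ⊔ m.initialIdeal J := by
  conv_lhs => rw [initialIdeal_eq_span]
  refine Ideal.span_le.2 ?_
  rintro _ ⟨_, ⟨w, hw, hw0, rfl⟩, rfl⟩
  obtain ⟨f, hf, g, hg, rfl⟩ := Submodule.mem_sup.1 hw
  rcases degree_add_mem_leadingExponents h hf hg hw0 with h1 | h1
  · exact (le_sup_left : m.initialIdeal I ≤ _) (monomial_mem_initialIdeal.2 h1)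
  · exact (le_sup_right : m.initialIdeal J ≤ _) (monomial_mem_initialIdeal.2 h1)

/-- The square of an element of in I ∩ in J lies in in I · in J ⊆ in(IJ) ⊆ in(I ∩ J). -/
theorem initialIdeal_inf_le_of_isRadical (h : (m.initialIdeal (I ⊓ J)).IsRadical) :
    m.initialIdeal I ⊓ m.initialIdeal J ≤ m.initialIdeal (I ⊓ J) := by
  intro f hf
  refine h ⟨2, ?_⟩
  rw [pow_two]
  exact initialIdeal_mono Ideal.mul_le_inf (initialIdeal_mul_le (Ideal.mul_mem_mul hf.1 hf.2))

theorem exists_initialIdeal_le_of_iInf {ι : Type*} [Finite ι]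
    {p : ι → Ideal (MvPolynomial σ 𝕜)} {P : Ideal (MvPolynomial σ 𝕜)} [hP : P.IsPrime]
    {s : Set ι} (h : m.initialIdeal (⨅ i ∈ s, p i) ≤ P) :
    ∃ i ∈ s, m.initialIdeal (p i) ≤ P := by
  classical
  have := Fintype.ofFinite ι
  have key : ∀ t : Finset ι, ∏ i ∈ t, m.initialIdeal (p i) ≤ m.initialIdeal (∏ i ∈ t, p i) := by
    intro t
    induction t using Finset.induction_on with
    | empty =>
      have : (1 : MvPolynomial σ 𝕜) = m.leadingTerm 1 := by
        rw [leadingTerm, m.degree_one, m.leadingCoeff_one]; rfl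
      simp only [Finset.prod_empty, Ideal.one_eq_top]
      rw [(Ideal.eq_top_iff_one (m.initialIdeal (⊤ : Ideal (MvPolynomial σ 𝕜)))).2
        (Ideal.subset_span ⟨1, trivial, this⟩)]
    | insert a t ha ih =>
      rw [Finset.prod_insert ha, Finset.prod_insert ha]
      exact (Ideal.mul_mono_right ih).trans initialIdeal_mul_le
  have h1 : ∏ i ∈ s.toFinset, p i ≤ ⨅ i ∈ s, p i := by
    refine Ideal.prod_le_inf.trans ?_
    simp [Finset.inf_eq_iInf]
  obtain ⟨i, hi, h2⟩ := (Ideal.IsPrime.prod_le hP).1 (((key _).trans (initialIdeal_mono h1)).trans h)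
  exact ⟨i, by simpa using hi, h2⟩

end MonomialOrder

/-! ### Heights of primes and algebraically independent variables -/

namespace MvPolynomial

section Localization

variable {τ R : Type*} [CommRing R] [IsDomain R]

attribute [local instance] algebraMvPolynomial

theorem disjoint_map_C_nonZeroDivisors {q : Ideal (MvPolynomial τ R)}
    (hq : ∀ r : R, C r ∈ q → r = 0) :
    Disjoint ((nonZeroDivisors R).map (C (σ := τ)) : Set (MvPolynomial τ R)) (q : Set _) := by
  rw [Set.disjoint_left]
  rintro _ ⟨r, hr, rfl⟩ h
  exact nonZeroDivisors.ne_zero hr (hq r h)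

theorem isMaximal_of_isIntegral_X {K : Type*} [Field K] (Q : Ideal (MvPolynomial τ K)) [Q.IsPrime]
    (hX : ∀ i : τ, IsIntegral K (Ideal.Quotient.mkₐ K Q (X i))) : Q.IsMaximal := by
  have hint : Algebra.IsIntegral K (MvPolynomial τ K ⧸ Q) := by
    refine ⟨fun x ↦ ?_⟩
    obtain ⟨f, rfl⟩ := Ideal.Quotient.mkₐ_surjective K Q x
    induction f using MvPolynomial.induction_on with
    | C a => exact (isIntegral_algebraMap (x := a)).map (Ideal.Quotient.mkₐ K Q)
    | add f g hf hg => rw [map_add]; exact hf.add hg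
    | mul_X f i hf => rw [map_mul]; exact hf.mul (hX i)
  exact Ideal.Quotient.maximal_of_isField _ (isField_of_isIntegral_of_isField' (Field.toIsField K))

variable [Finite τ]

/-- Inverting the nonzero constants keeps the height of q and leads to a polynomial ring over a
field, of dimension `Nat.card τ`. -/
theorem height_le_card_of_comap_C_eq_bot (q : Ideal (MvPolynomial τ R)) [q.IsPrime]
    (hq : ∀ r : R, C r ∈ q → r = 0) : q.height ≤ Nat.card τ := by
  have hd := disjoint_map_C_nonZeroDivisors hq
  rw [← IsLocalization.height_map_of_disjoint (S := MvPolynomial τ (FractionRing R))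
    ((nonZeroDivisors R).map (C (σ := τ))) q hd]
  have := IsLocalization.isPrime_of_isPrime_disjoint ((nonZeroDivisors R).map (C (σ := τ)))
    (MvPolynomial τ (FractionRing R)) q ‹_› hd
  have h := Ideal.height_le_ringKrullDim_of_isPrime
    (I := q.map (algebraMap _ (MvPolynomial τ (FractionRing R))))
  rw [MvPolynomial.ringKrullDim_of_isNoetherianRing, ringKrullDim_eq_zero_of_field, zero_add] at h
  exact_mod_cast h

/-- Maximal ideals of a polynomial ring over a field have height the number of variables. -/
theorem height_eq_card_of_isMaximal {K : Type*} [Field K] (q : Ideal (MvPolynomial τ K))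
    [hq : q.IsMaximal] : q.height = Nat.card τ := by
  induction τ using Finite.induction_empty_option with
  | of_equiv e ih =>
    have : (q.comap (renameEquiv K e).toRingEquiv).IsMaximal :=
      Ideal.comap_isMaximal_of_equiv (renameEquiv K e).toRingEquiv
    rw [← Nat.card_congr e, ← ih (q.comap (renameEquiv K e).toRingEquiv), RingEquiv.height_comap]
  | h_empty =>
    have h : q.height ≤ ringKrullDim (MvPolynomial PEmpty K) :=
      Ideal.height_le_ringKrullDim_of_isPrime
    rw [MvPolynomial.ringKrullDim_of_isNoetherianRing, ringKrullDim_eq_zero_of_field, zero_add] at h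
    have h' : q.height ≤ Nat.card PEmpty := by exact_mod_cast h
    simpa using h'
  | @h_option τ _ ih =>
    let e := (optionEquivLeft K τ).toRingEquiv
    let P := q.comap e.symm
    have : P.IsMaximal := Ideal.comap_isMaximal_of_equiv e.symm
    -- Polynomial rings over a field are Jacobson, so the contraction is maximal and the induction
    -- hypothesis applies to it.
    have h1 : (P.comap Polynomial.C).IsMaximal := 
      Polynomial.isMaximal_comap_C_of_isJacobsonRing P
    have : P.LiesOver (P.comap Polynomial.C) := ⟨rfl⟩
    rw [← RingEquiv.height_comap e.symm q]
    change P.height = _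
    rw [Polynomial.height_eq_height_add_one (P.comap Polynomial.C) P, ih (P.comap Polynomial.C)]
    simp

/-- Over the fraction field the quotient is generated by algebraic elements, so the localized prime
is maximal. -/
theorem height_eq_card_of_isAlgebraic (q : Ideal (MvPolynomial τ R)) [q.IsPrime]
    (hq : ∀ r : R, C r ∈ q → r = 0)
    (halg : ∀ i : τ, ∃ F : Polynomial R, F ≠ 0 ∧ F.eval₂ C (X i : MvPolynomial τ R) ∈ q) :
    q.height = Nat.card τ := by
  suffices h : ∀ (K : Type _) [Field K] [Algebra R K] [IsFractionRing R K],
      q.height = Nat.card τ from h (FractionRing R)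
  intro K _ _ _
  have hd := disjoint_map_C_nonZeroDivisors hq
  rw [← IsLocalization.height_map_of_disjoint (S := MvPolynomial τ K)
    ((nonZeroDivisors R).map (C (σ := τ))) q hd]
  have hprime := IsLocalization.isPrime_of_isPrime_disjoint ((nonZeroDivisors R).map (C (σ := τ)))
    (MvPolynomial τ K) q ‹_› hd
  set Q := q.map (algebraMap _ (MvPolynomial τ K))
  have : Q.IsMaximal := by
    refine isMaximal_of_isIntegral_X Q fun i ↦ ?_
    obtain ⟨F, hF0, hF⟩ := halg i
    refine IsAlgebraic.isIntegral ⟨F.map (algebraMap R K), ?_, ?_⟩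
    · rwa [Ne, Polynomial.map_eq_zero_iff (IsFractionRing.injective R K)]
    · rw [Polynomial.aeval_algHom_apply, Ideal.Quotient.mkₐ_eq_mk, Ideal.Quotient.eq_zero_iff_mem]
      have h1 : MvPolynomial.map (algebraMap R K) (F.eval₂ C (X i)) ∈ Q :=
        Ideal.mem_map_of_mem _ hF
      convert! h1 using 1
      simp only [Polynomial.aeval_def, Polynomial.eval₂_map, Polynomial.hom_eval₂, map_X]
      congr 1
      ext1 r
      simp [algebraMap_eq]
  exact height_eq_card_of_isMaximal Q

end Localization

section Split

variable {σ : Type*} (𝕜 : Type*) [Field 𝕜] (A : Set σ)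

open Classical in
/-- The polynomial ring, regarded as polynomials in the variables outside `A` over the polynomial
ring in the variables in `A`. -/
noncomputable def splitEquiv :
    MvPolynomial σ 𝕜 ≃ₐ[𝕜] MvPolynomial ↥Aᶜ (MvPolynomial A 𝕜) :=
  (renameEquiv 𝕜 ((Equiv.Set.sumCompl A).symm.trans (Equiv.sumComm _ _))).trans
    (sumAlgEquiv 𝕜 ↥Aᶜ A)

variable {A}

theorem splitEquiv_X_mem (i : A) : splitEquiv 𝕜 A (X (i : σ)) = C (X i) := by
  simp [splitEquiv]

theorem splitEquiv_X_compl (i : ↥Aᶜ) : splitEquiv 𝕜 A (X (i : σ)) = X i := by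
  simp [splitEquiv]

theorem splitEquiv_rename (g : MvPolynomial A 𝕜) :
    splitEquiv 𝕜 A (rename (↑) g) = C g := by
  induction g using MvPolynomial.induction_on with
  | C a => simp [splitEquiv]
  | add f g hf hg => simp [hf, hg]
  | mul_X f i hf => simp [hf, splitEquiv_X_mem]

variable {𝕜} [Finite σ]

theorem height_le_card_compl (q : Ideal (MvPolynomial σ 𝕜)) [q.IsPrime]
    (hq : ∀ g : MvPolynomial A 𝕜, rename (↑) g ∈ q → g = 0) : q.height ≤ Nat.card ↥Aᶜ := by
  let e := (splitEquiv 𝕜 A).toRingEquiv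
  rw [← RingEquiv.height_comap e.symm q]
  refine height_le_card_of_comap_C_eq_bot _ fun g hg ↦ hq g ?_
  rw [Ideal.mem_comap] at hg
  convert! hg
  rw [eq_comm, RingEquiv.symm_apply_eq]
  exact (splitEquiv_rename 𝕜 g).symm

theorem height_eq_card_compl (q : Ideal (MvPolynomial σ 𝕜)) [q.IsPrime]
    (hq : ∀ g : MvPolynomial A 𝕜, rename (↑) g ∈ q → g = 0)
    (halg : ∀ i ∉ A, ∃ F : Polynomial (MvPolynomial A 𝕜), F ≠ 0 ∧
      F.eval₂ (rename (↑) : MvPolynomial A 𝕜 →ₐ[𝕜] MvPolynomial σ 𝕜).toRingHom (X i) ∈ q) :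
    q.height = Nat.card ↥Aᶜ := by
  let e := (splitEquiv 𝕜 A).toRingEquiv
  rw [← RingEquiv.height_comap e.symm q]
  refine height_eq_card_of_isAlgebraic _ (fun g hg ↦ hq g ?_) fun i ↦ ?_
  · rw [Ideal.mem_comap] at hg
    convert! hg
    rw [eq_comm, RingEquiv.symm_apply_eq]
    exact (splitEquiv_rename 𝕜 g).symm
  · obtain ⟨F, hF0, hF⟩ := halg i i.2
    refine ⟨F, hF0, ?_⟩
    rw [Ideal.mem_comap]
    convert! hF
    rw [RingEquiv.symm_apply_eq]
    change _ = (splitEquiv 𝕜 A).toAlgHom.toRingHom _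
    rw [Polynomial.hom_eval₂]
    congr 1
    · exact RingHom.ext fun g ↦ (splitEquiv_rename 𝕜 g).symm
    · exact (splitEquiv_X_compl 𝕜 i).symm

end Split

section Variables

variable {σ 𝕜 : Type*} [Field 𝕜]

/-- Setting the variables of B to zero changes nothing modulo P. This kernel stands for the ideal
generated by these variables; it is prime because the target is a domain. -/
theorem ker_aeval_le (B : Finset σ) [DecidablePred (· ∈ B)] {P : Ideal (MvPolynomial σ 𝕜)}
    (hP : ∀ i ∈ B, X i ∈ P) :
    RingHom.ker (aeval (R := 𝕜) fun i ↦ if i ∈ B then (0 : MvPolynomial σ 𝕜) else X i) ≤ P := by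
  intro f hf
  have h : (Ideal.Quotient.mkₐ 𝕜 P).comp
      (aeval fun i ↦ if i ∈ B then (0 : MvPolynomial σ 𝕜) else X i) = Ideal.Quotient.mkₐ 𝕜 P := by
    ext i
    by_cases hi : i ∈ B
    · simpa [hi] using (Ideal.Quotient.eq_zero_iff_mem.2 (hP i hi)).symm
    · simp [hi]
  have h1 := DFunLike.congr_fun h f
  rw [AlgHom.comp_apply, RingHom.mem_ker.1 hf, map_zero] at h1
  exact Ideal.Quotient.eq_zero_iff_mem.1 h1.symm

theorem card_le_height_of_X_mem [Finite σ] (B : Finset σ) (P : Ideal (MvPolynomial σ 𝕜))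
    [P.IsPrime]
    (hP : ∀ i ∈ B, X i ∈ P) : B.card ≤ P.height := by
  classical
  have (B : Finset σ) : (RingHom.ker
      (aeval (R := 𝕜) fun i ↦ if i ∈ B then (0 : MvPolynomial σ 𝕜) else X i)).IsPrime :=
    RingHom.ker_isPrime _
  refine le_trans ?_ (Ideal.height_mono (ker_aeval_le B hP))
  clear hP
  induction B using Finset.induction_on with
  | empty => simp
  | insert a B ha ih =>
    rw [Finset.card_insert_of_notMem ha, Nat.cast_add, Nat.cast_one]
    refine (add_le_add_left ih 1).trans (Ideal.height_add_one_le_of_lt_of_isPrime ?_)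
    refine SetLike.lt_iff_le_and_exists.2 ⟨ker_aeval_le B fun i hi ↦ ?_, X a, ?_, ?_⟩
    · simp [RingHom.mem_ker, hi]
    · simp [RingHom.mem_ker]
    · simp [RingHom.mem_ker, ha]

/-- Krull's height theorem; the additive form avoids subtraction in `ℕ∞`. -/
theorem height_span_X_le [Fintype σ] (A : Finset σ) :
    (Ideal.span (X '' (A : Set σ)ᶜ : Set (MvPolynomial σ 𝕜))).height + A.card ≤
      Fintype.card σ := by
  classical
  have hne : Ideal.span (X '' (A : Set σ)ᶜ : Set (MvPolynomial σ 𝕜)) ≠ ⊤ := by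
    rw [Ne, Ideal.eq_top_iff_one, mem_ideal_span_X_image]
    intro h
    simpa using h 0 (by simp)
  obtain ⟨P, hP⟩ := Ideal.nonempty_minimalPrimes hne
  have h1 := (Ideal.height_mono hP.1.2).trans
    (Ideal.height_le_card_of_mem_minimalPrimes_span ((Set.toFinite _).image _) hP)
  have h2 : (X '' (A : Set σ)ᶜ : Set (MvPolynomial σ 𝕜)).ncard + A.card ≤ Fintype.card σ := by
    refine (Nat.add_le_add_right (Set.ncard_image_le (Set.toFinite _)) _).trans ?_
    rw [← Finset.coe_compl, Set.ncard_coe_finset, Finset.card_compl_add_card]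
  calc _ ≤ (((X '' (A : Set σ)ᶜ : Set (MvPolynomial σ 𝕜)).ncard + A.card : ℕ) : ℕ∞) := by
        push_cast
        gcongr
    _ ≤ _ := by exact_mod_cast h2

end Variables

end MvPolynomial

/-! ### Invariance of the height under passing to the initial ideal -/

namespace MonomialOrder

open scoped MonomialOrder

variable {σ 𝕜 : Type*} [Field 𝕜] {m : MonomialOrder σ}

theorem exists_X_mem_of_monomial_mem {P : Ideal (MvPolynomial σ 𝕜)} [hP : P.IsPrime] {a : σ →₀ ℕ}
    (h : monomial a (1 : 𝕜) ∈ P) : ∃ i ∈ a.support, X i ∈ P := by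
  rw [monomial_eq, C_1, one_mul, Finsupp.prod, hP.prod_mem_iff] at h
  obtain ⟨i, hi, h⟩ := h
  exact ⟨i, hi, hP.mem_of_pow_mem _ h⟩

theorem support_subset_of_mem_support_rename {A : Set σ} {g : MvPolynomial A 𝕜} {a : σ →₀ ℕ}
    (h : a ∈ (rename ((↑) : A → σ) g).support) : (a.support : Set σ) ⊆ A := by
  classical
  rw [support_rename_of_injective Subtype.val_injective, Finset.mem_image] at h
  obtain ⟨b, -, rfl⟩ := h
  intro i hi
  have := Finsupp.mapDomain_support hi
  simp only [Finset.mem_image] at this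
  obtain ⟨j, -, rfl⟩ := this
  exact j.2

/-- Let P be a minimal prime of in J and A the variables outside P. A nonzero element of J in the
variables A would put one of them in P, so J lies in a prime q meeting 𝕜[A] in 0, and ht q ≤ |Aᶜ| ≤
ht P. -/
theorem height_le_height_initialIdeal [Finite σ] (J : Ideal (MvPolynomial σ 𝕜)) :
    J.height ≤ (m.initialIdeal J).height := by
  classical
  have := Fintype.ofFinite σ
  rw [(m.initialIdeal J).height_eq_inf_minimalPrimes]
  refine le_iInf₂ fun P hP ↦ ?_
  have := hP.isPrime
  let B : Finset σ := {i | X i ∈ P}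
  let A : Set σ := (B : Set σ)ᶜ
  have hd : Disjoint (J : Set (MvPolynomial σ 𝕜))
      ((nonZeroDivisors (MvPolynomial A 𝕜)).map (rename (↑) : _ →ₐ[𝕜] MvPolynomial σ 𝕜)) := by
    rw [Set.disjoint_right]
    rintro _ ⟨g, hg, rfl⟩ hgJ
    have hg0 : rename ((↑) : A → σ) g ≠ 0 := by
      rw [Ne, map_eq_zero_iff _ (rename_injective _ Subtype.val_injective)]
      exact nonZeroDivisors.ne_zero hg
    obtain ⟨i, hi, hiP⟩ := exists_X_mem_of_monomial_mem
      (hP.1.2 (monomial_mem_initialIdeal.2 ⟨_, hgJ, hg0, rfl⟩))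
    exact support_subset_of_mem_support_rename (m.degree_mem_support hg0) hi (by simpa [B] using hiP)
  obtain ⟨q, hq, hJq, hdq⟩ := Ideal.exists_le_prime_disjoint _ _ hd
  have h1 : q.height ≤ Nat.card ↥Aᶜ := height_le_card_compl q fun g hg ↦ by
    by_contra hg0
    exact Set.disjoint_left.1 hdq hg ⟨g, mem_nonZeroDivisors_of_ne_zero hg0, rfl⟩
  have h2 : Nat.card ↥Aᶜ = B.card := by simp [A]
  rw [h2] at h1
  exact (Ideal.height_mono hJq).trans (h1.trans (card_le_height_of_X_mem B P (by simp [B])))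

/-- Replacing repeatedly exponents by smaller ones, along finitely many rules, increases the total
degree at most linearly. -/
theorem exists_degree_le_mul_degree [Finite σ] {E : Type*} [Finite E] (a b : E → σ →₀ ℕ)
    (h : ∀ e, b e ≺[m] a e) : ∃ K : ℕ, ∀ (u v : σ →₀ ℕ) (c : E →₀ ℕ),
      u + Finsupp.linearCombination ℕ b c = v + Finsupp.linearCombination ℕ a c →
      v.degree ≤ K * u.degree := by
  classical
  let f : ((σ →₀ ℕ) × (σ →₀ ℕ) × (E →₀ ℕ)) →+ (σ →₀ ℕ) :=
    (AddMonoidHom.fst _ _) + (Finsupp.linearCombination ℕ b).toAddMonoidHom.comp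
      ((AddMonoidHom.snd _ _).comp (AddMonoidHom.snd _ _))
  let g : ((σ →₀ ℕ) × (σ →₀ ℕ) × (E →₀ ℕ)) →+ (σ →₀ ℕ) :=
    (AddMonoidHom.fst _ _).comp (AddMonoidHom.snd _ _) +
      (Finsupp.linearCombination ℕ a).toAddMonoidHom.comp
      ((AddMonoidHom.snd _ _).comp (AddMonoidHom.snd _ _))
  -- The solutions (u, v, c) form a finitely generated monoid, so by additivity the bound need only
  -- be checked on generators.
  obtain ⟨S, hS⟩ := AddSubmonoid.fg_eqLocusM f g
  have hmono : ∀ c : E →₀ ℕ, c ≠ 0 →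
      Finsupp.linearCombination ℕ b c ≺[m] Finsupp.linearCombination ℕ a c := by
    intro c hc
    simp only [Finsupp.linearCombination_apply, Finsupp.sum, map_sum, map_nsmul]
    refine Finset.sum_lt_sum_of_nonempty (Finsupp.support_nonempty_iff.2 hc) fun e he ↦ ?_
    exact nsmul_lt_nsmul_right (Finsupp.mem_support_iff.1 he) (h e)
  -- If u = 0 and c ≠ 0, then Σ b c = v + Σ a c ≥ Σ a c > Σ b c, which is absurd; so c = 0 and v =
  -- 0.
  have hgen : ∀ x ∈ AddMonoidHom.eqLocusM f g, x.1 = 0 → x.2.1 = 0 := by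
    rintro ⟨u, v, c⟩ hx rfl
    change 0 + Finsupp.linearCombination ℕ b c = v + Finsupp.linearCombination ℕ a c at hx
    change v = 0
    by_cases hc : c = 0
    · simpa [hc] using hx.symm
    have h1 := hmono c hc
    rw [zero_add] at hx
    rw [hx, map_add] at h1
    exact absurd h1 (not_lt.2 (le_add_of_nonneg_left bot_le))
  refine ⟨S.sup fun x ↦ x.2.1.degree, ?_⟩
  suffices key : ∀ x ∈ AddMonoidHom.eqLocusM f g,
      x.2.1.degree ≤ (S.sup fun x ↦ x.2.1.degree) * x.1.degree from
    fun u v c huv ↦ key (u, v, c) huv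
  intro x hx
  have hSle : ∀ x ∈ S, x ∈ AddMonoidHom.eqLocusM f g := fun x hx ↦
    hS ▸ AddSubmonoid.subset_closure hx
  rw [← hS] at hx
  induction hx using AddSubmonoid.closure_induction with
  | mem x hx =>
    by_cases h0 : x.1 = 0
    · simp [hgen x (hSle x hx) h0]
    · have h1 : 1 ≤ x.1.degree := Nat.one_le_iff_ne_zero.2 (fun h ↦ h0 ((Finsupp.degree_eq_zero_iff _).1 h))
      have h2 := Finset.le_sup (f := fun x : (σ →₀ ℕ) × (σ →₀ ℕ) × (E →₀ ℕ) ↦ x.2.1.degree) hx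
      nlinarith
  | zero => simp
  | add x y _ _ hx hy =>
    simp only [Prod.snd_add, Prod.fst_add, map_add, mul_add]
    exact add_le_add hx hy

/-- Modulo `I`, every monomial is a linear combination of monomials that are divisible by no leading
monomial of the given elements of `I` and whose total degree is linearly bounded. -/
theorem exists_monomial_mem_sup_span [Finite σ] {ι : Type*} [Finite ι]
    {I : Ideal (MvPolynomial σ 𝕜)} (f : ι → MvPolynomial σ 𝕜) (hf : ∀ j, f j ∈ I)
    (hf0 : ∀ j, f j ≠ 0) : ∃ K : ℕ, ∀ u : σ →₀ ℕ, monomial u (1 : 𝕜) ∈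
      I.restrictScalars 𝕜 ⊔ Submodule.span 𝕜 ((fun v ↦ monomial v (1 : 𝕜)) ''
        {v | v.degree ≤ K * u.degree ∧ ∀ j, ¬ m.degree (f j) ≤ v}) := by
  classical
  let E := Σ j : ι, {b // b ∈ (f j).support.erase (m.degree (f j))}
  let a : E → σ →₀ ℕ := fun e ↦ m.degree (f e.1)
  let b : E → σ →₀ ℕ := fun e ↦ e.2
  have hlt : ∀ e, b e ≺[m] a e := by
    rintro ⟨j, b, hb⟩
    rw [Finset.mem_erase] at hb
    exact lt_of_le_of_ne (m.le_degree hb.2) fun e ↦ hb.1 (m.toSyn.injective e)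
  obtain ⟨K, hK⟩ := exists_degree_le_mul_degree a b hlt
  refine ⟨K, fun u ↦ ?_⟩
  set W := I.restrictScalars 𝕜 ⊔ Submodule.span 𝕜 ((fun v ↦ monomial v (1 : 𝕜)) ''
        {v | v.degree ≤ K * u.degree ∧ ∀ j, ¬ m.degree (f j) ≤ v})
  -- The vector c records how often each rule (leading exponent to lower exponent) was applied on
  -- the way from u to v.
  suffices key : ∀ (s : m.syn) (v : σ →₀ ℕ) (c : E →₀ ℕ), m.toSyn v = s →
      u + Finsupp.linearCombination ℕ b c = v + Finsupp.linearCombination ℕ a c →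
      monomial v (1 : 𝕜) ∈ W from key _ u 0 rfl (by simp)
  intro s
  induction s using WellFoundedLT.induction with
  | ind s ih =>
    rintro v c rfl hc
    by_cases hv : ∀ j, ¬ m.degree (f j) ≤ v
    · exact Submodule.mem_sup_right (Submodule.subset_span ⟨v, ⟨hK u v c hc, hv⟩, rfl⟩)
    push Not at hv
    obtain ⟨j, hj⟩ := hv
    have hlc := m.leadingCoeff_ne_zero_iff.2 (hf0 j)
    have h1 : monomial (v - m.degree (f j)) (1 : 𝕜) * f j ∈ W :=
      Submodule.mem_sup_left (I.mul_mem_left _ (hf j))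
    have h2 : ∀ d ∈ (f j).support.erase (m.degree (f j)),
        monomial (v - m.degree (f j) + d) (coeff d (f j)) ∈ W := by
      intro d hd
      rw [← mul_one (coeff d (f j)), ← smul_eq_mul, ← smul_monomial]
      refine W.smul_mem _ (ih _ ?_ _ (c + Finsupp.single ⟨j, d, hd⟩ 1) rfl ?_)
      · conv_rhs => rw [← tsub_add_cancel_of_le hj]
        rw [map_add, map_add]
        have := hlt ⟨j, d, hd⟩
        gcongr
      · simp only [map_add, Finsupp.linearCombination_single, one_smul]
        rw [← add_assoc, hc]
        conv_lhs => rw [← tsub_add_cancel_of_le hj]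
        change _ + d = _ + (_ + m.degree (f j))
        ac_rfl
    have h3 : monomial (v - m.degree (f j)) (1 : 𝕜) * f j =
        monomial v (m.leadingCoeff (f j)) + ∑ d ∈ (f j).support.erase (m.degree (f j)),
          monomial (v - m.degree (f j) + d) (coeff d (f j)) := by
      have h := (f j).as_sum
      rw [← Finset.add_sum_erase _ _ (m.degree_mem_support (hf0 j))] at h
      refine (congrArg (monomial (v - m.degree (f j)) (1 : 𝕜) * ·) h).trans ?_
      simp only [mul_add, Finset.mul_sum, monomial_mul, one_mul, tsub_add_cancel_of_le hj]
      rfl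
    have h4 : monomial v (m.leadingCoeff (f j)) ∈ W := by
      rw [← sub_eq_iff_eq_add] at h3
      rw [← h3]
      exact W.sub_mem h1 (W.sum_mem h2)
    have h5 := W.smul_mem (m.leadingCoeff (f j))⁻¹ h4
    rwa [smul_monomial, smul_eq_mul, inv_mul_cancel₀ hlc] at h5

/-- If every set of `d + 1` variables supports one of the exponents `a j`, then the number of
exponents in a box divisible by none of them grows at most like the `d`-th power of its side. -/
theorem exists_card_not_le_le [Finite σ] {ι : Type*} [Finite ι] (d : ℕ) (a : ι → σ →₀ ℕ)
    (ha : ∀ A : Finset σ, A.card = d + 1 → ∃ j, (a j).support ⊆ A) : ∃ K : ℕ, ∀ L : ℕ,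
      ∃ V : Finset (σ →₀ ℕ), V.card ≤ K * (L + 1) ^ d ∧
        ∀ v : σ →₀ ℕ, (∀ i, v i ≤ L) → (∀ j, ¬ a j ≤ v) → v ∈ V := by
  classical
  have := Fintype.ofFinite σ
  have := Fintype.ofFinite ι
  let M := (Finset.univ.sup fun j ↦ Finset.univ.sup fun i ↦ a j i) + 1
  have hM : ∀ j i, a j i ≤ M := fun j i ↦ by
    have h1 := Finset.le_sup (f := fun j ↦ Finset.univ.sup fun i ↦ a j i) (Finset.mem_univ j)
    have h2 := Finset.le_sup (f := fun i ↦ a j i) (Finset.mem_univ i)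
    exact (h2.trans h1).trans (Nat.le_succ _)
  -- The factors bound the number of sets T of large coordinates and the choices for the small
  -- coordinates.
  refine ⟨2 ^ Fintype.card σ * M ^ Fintype.card σ, fun L ↦ ?_⟩
  let box : Finset σ → Finset (σ → ℕ) := fun T ↦
    Fintype.piFinset fun i ↦ Finset.range (if i ∈ T then L + 1 else M)
  have hbox : ∀ T : Finset σ, T.card ≤ d → (box T).card ≤ M ^ Fintype.card σ * (L + 1) ^ d := by
    intro T hT
    simp only [box, Fintype.card_piFinset, Finset.card_range]
    rw [Finset.prod_ite, Finset.prod_const, Finset.prod_const, mul_comm]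
    refine Nat.mul_le_mul (Nat.pow_le_pow_right (Nat.succ_pos _) (Finset.card_le_univ _))
      (Nat.pow_le_pow_right (Nat.succ_pos _) (le_trans (le_of_eq ?_) hT))
    congr 1
    ext i
    simp
  refine ⟨((Finset.univ.filter fun T : Finset σ ↦ T.card ≤ d).biUnion box).image
    Finsupp.equivFunOnFinite.symm, ?_, fun v hvL hv ↦ ?_⟩
  · refine Finset.card_image_le.trans (Finset.card_biUnion_le.trans ?_)
    refine (Finset.sum_le_card_nsmul _ _ _ fun T hT ↦ hbox T (by simpa using hT)).trans ?_
    rw [smul_eq_mul, mul_assoc]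
    refine Nat.mul_le_mul_right _ ((Finset.card_le_univ _).trans ?_)
    simp
  · rw [Finset.mem_image]
    refine ⟨v, ?_, by ext; simp⟩
    -- If T had more than d elements, it would contain the support of some `a j`, and then `a j ≤
    -- v`.
    let T : Finset σ := {i | M ≤ v i}
    rw [Finset.mem_biUnion]
    refine ⟨T, ?_, ?_⟩
    · simp only [Finset.mem_filter_univ]
      by_contra hT
      obtain ⟨A, hAT, hA⟩ := Finset.exists_subset_card_eq (Nat.succ_le_of_lt (not_le.1 hT))
      obtain ⟨j, hj⟩ := ha A hA
      refine hv j fun i ↦ ?_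
      by_cases hi : a j i = 0
      · simp [hi]
      · have : i ∈ T := hAT (hj (Finsupp.mem_support_iff.2 hi))
        exact (hM j i).trans (by simpa [T] using this)
    · simp only [box, Fintype.mem_piFinset, Finset.mem_range]
      intro i
      split_ifs with hi
      · exact Nat.lt_succ_of_le (hvL i)
      · simpa [T] using hi

/-- If a set of variables is algebraically independent modulo `I`, then some set of variables of the
same size supports no leading monomial of an element of `I`. -/
theorem exists_card_eq_forall_not_support_subset [Finite σ] {I : Ideal (MvPolynomial σ 𝕜)}
    (hI : I ≠ ⊤) (A : Finset σ)
    (hA : ∀ g : MvPolynomial A 𝕜, rename (↑) g ∈ I → g = 0) :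
    ∃ A' : Finset σ, A'.card = A.card ∧ ∀ a ∈ m.leadingExponents I, ¬ a.support ⊆ A' := by
  classical
  have := Fintype.ofFinite σ
  by_contra! hcon
  rcases hd : A.card with _ | d
  · obtain ⟨a, ⟨g, hg, hg0, hga⟩, ha⟩ := hcon ∅ (by simp [hd])
    have : a = 0 := by simpa using ha
    rw [this] at hga
    rw [m.eq_C_of_degree_eq_zero hga] at hg
    exact hI (Ideal.eq_top_of_isUnit_mem _ hg
      ((isUnit_iff_ne_zero.2 (m.leadingCoeff_ne_zero_iff.2 hg0)).map C))
  rw [hd] at hcon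
  have h1 : ∀ T : {T : Finset σ // T.card = d + 1},
      ∃ g ∈ I, g ≠ 0 ∧ (m.degree g).support ⊆ T.1 := by
    rintro ⟨T, hT⟩
    obtain ⟨_, ⟨g, hg, hg0, rfl⟩, h⟩ := hcon T hT
    exact ⟨g, hg, hg0, h⟩
  choose f hf hf0 hfs using h1
  obtain ⟨K₁, hK₁⟩ := exists_monomial_mem_sup_span (m := m) f hf hf0
  obtain ⟨K₂, hK₂⟩ := exists_card_not_le_le d (fun T ↦ m.degree (f T))
    fun T hT ↦ ⟨⟨T, hT⟩, hfs _⟩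
  -- The (N + 1)^(d + 1) monomials in A with exponents at most N are independent modulo I, but are
  -- spanned by boundedly many reduced monomials.
  have hmain : ∀ N : ℕ, (N + 1) ^ (d + 1) ≤ K₂ * (K₁ * ((d + 1) * N) + 1) ^ d := by
    intro N
    obtain ⟨V, hVcard, hV⟩ := hK₂ (K₁ * ((d + 1) * N))
    let φ : MvPolynomial A 𝕜 →ₐ[𝕜] (MvPolynomial σ 𝕜 ⧸ I) :=
      (Ideal.Quotient.mkₐ 𝕜 I).comp (rename (↑))
    have hφ : LinearMap.ker φ.toLinearMap = ⊥ := by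
      refine LinearMap.ker_eq_bot'.2 fun g hg ↦ hA g ?_
      exact Ideal.Quotient.eq_zero_iff_mem.1 hg
    let emb : (A → Fin (N + 1)) → (A →₀ ℕ) := fun k ↦ Finsupp.equivFunOnFinite.symm fun i ↦ (k i : ℕ)
    have hemb : Function.Injective emb := by
      intro k l hkl
      have := Finsupp.equivFunOnFinite.symm.injective hkl
      funext i
      exact Fin.ext (congrFun this i)
    have hli := ((basisMonomials A 𝕜).linearIndependent.map' φ.toLinearMap hφ).comp emb hemb
    let W : Finset (MvPolynomial σ 𝕜 ⧸ I) :=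
      V.image fun v ↦ Ideal.Quotient.mkₐ 𝕜 I (monomial v 1)
    have hspan : Set.range ((φ.toLinearMap ∘ basisMonomials A 𝕜) ∘ emb) ≤
        Submodule.span 𝕜 (W : Set (MvPolynomial σ 𝕜 ⧸ I)) := by
      rintro _ ⟨k, rfl⟩
      let u := Finsupp.mapDomain ((↑) : A → σ) (emb k)
      have hu : u.degree ≤ (d + 1) * N := by
        rw [Finsupp.degree_mapDomain, Finsupp.degree_eq_sum]
        calc ∑ i, emb k i ≤ ∑ i : A, N := Finset.sum_le_sum fun i _ ↦ Nat.lt_succ_iff.1 (k i).2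
          _ = _ := by simp [hd]
      have h2 := Submodule.mem_map_of_mem (f := (Ideal.Quotient.mkₐ 𝕜 I).toLinearMap) (hK₁ u)
      have h3 : ((φ.toLinearMap ∘ basisMonomials A 𝕜) ∘ emb) k =
          (Ideal.Quotient.mkₐ 𝕜 I).toLinearMap (monomial u 1) := by
        simp [φ, u, rename_monomial]
      rw [h3]
      refine SetLike.le_def.1 ?_ h2
      rw [Submodule.map_sup, sup_le_iff]
      constructor
      · rintro _ ⟨g, hg, rfl⟩
        have : (Ideal.Quotient.mkₐ 𝕜 I).toLinearMap g = 0 := Ideal.Quotient.eq_zero_iff_mem.2 hg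
        rw [this]
        exact Submodule.zero_mem _
      · rw [Submodule.map_span, Submodule.span_le]
        rintro _ ⟨_, ⟨v, ⟨hv1, hv2⟩, rfl⟩, rfl⟩
        refine Submodule.subset_span (Finset.mem_coe.2 (Finset.mem_image_of_mem _ (hV v ?_ hv2)))
        exact fun i ↦ ((Finsupp.le_degree i v).trans hv1).trans (Nat.mul_le_mul_left _ hu)
    have hcard := linearIndependent_le_span_aux' _ hli W hspan
    have hcard' : (N + 1) ^ (d + 1) ≤ W.card := by simpa [hd] using hcard
    exact hcard'.trans (Finset.card_image_le.trans hVcard)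
  -- At N = K the upper bound is at most K (K + 1)^d, less than (K + 1)^(d + 1).
  let K := K₂ * (K₁ * (d + 1) + 1) ^ d
  have h2 := hmain K
  have h3 : K₂ * (K₁ * ((d + 1) * K) + 1) ^ d ≤ K * (K + 1) ^ d := by
    rw [show K * (K + 1) ^ d = K₂ * ((K₁ * (d + 1) + 1) * (K + 1)) ^ d by
      simp only [K]; rw [mul_pow, mul_assoc]]
    refine Nat.mul_le_mul_left _ (Nat.pow_le_pow_left ?_ _)
    nlinarith
  have h4 : K * (K + 1) ^ d < (K + 1) ^ (d + 1) := by
    rw [pow_succ, mul_comm]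
    exact Nat.mul_lt_mul_of_pos_left (Nat.lt_succ_self _) (by positivity)
  omega

/-- The relation is read as a polynomial in X_i over 𝕜[A]. Applied to a maximal independent A, this
supplies the algebraicity needed in `height_eq_card_compl`. -/
theorem exists_eval₂_mem_of_not_independent [DecidableEq σ] {p : Ideal (MvPolynomial σ 𝕜)}
    {A : Finset σ} {i : σ} (hi : i ∉ A) {g : MvPolynomial ↥(insert i A) 𝕜} (hg0 : g ≠ 0)
    (hg : rename (↑) g ∈ p) : ∃ F : Polynomial (MvPolynomial A 𝕜), F ≠ 0 ∧
      F.eval₂ (rename (↑) : MvPolynomial A 𝕜 →ₐ[𝕜] MvPolynomial σ 𝕜).toRingHom (X i) ∈ p := by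
  let e := Finset.subtypeInsertEquivOption hi
  refine ⟨optionEquivLeft 𝕜 A (rename e g), ?_, ?_⟩
  · rw [Ne, EmbeddingLike.map_eq_zero_iff, map_eq_zero_iff _ (rename_injective _ e.injective)]
    exact hg0
  · have key : ∀ h : MvPolynomial (Option A) 𝕜, (optionEquivLeft 𝕜 A h).eval₂
        (rename (↑) : MvPolynomial A 𝕜 →ₐ[𝕜] MvPolynomial σ 𝕜).toRingHom (X i) =
        aeval (fun o : Option A ↦ o.elim (X i : MvPolynomial σ 𝕜) fun j ↦ X (j : σ)) h := by
      intro h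
      induction h using MvPolynomial.induction_on with
      | C a => simp [algebraMap_eq]
      | add f g hf hg => simp only [map_add, Polynomial.eval₂_add, hf, hg]
      | mul_X f o hf =>
        simp only [map_mul, Polynomial.eval₂_mul, hf]
        cases o <;> simp
    rw [key, aeval_rename]
    convert! hg using 1
    refine DFunLike.congr_fun (algHom_ext fun j ↦ ?_) g
    rw [aeval_X, rename_X, Function.comp_apply]
    by_cases hj : (j : σ) = i
    · have : e j = none := by simp [e, Finset.subtypeInsertEquivOption, hj]
      simp [this, hj]
    · have : e j = some ⟨j, Finset.mem_of_mem_insert_of_ne j.2 hj⟩ := by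
        simp [e, Finset.subtypeInsertEquivOption, hj]
      simp [this]

theorem height_initialIdeal_le_height [Finite σ] (I : Ideal (MvPolynomial σ 𝕜)) :
    (m.initialIdeal I).height ≤ I.height := by
  classical
  have := Fintype.ofFinite σ
  rw [I.height_eq_inf_minimalPrimes]
  refine le_iInf₂ fun p hp ↦ (Ideal.height_mono (initialIdeal_mono hp.1.2)).trans ?_
  have := hp.isPrime
  let S : Finset (Finset σ) := {A | ∀ g : MvPolynomial A 𝕜, rename (↑) g ∈ p → g = 0}
  have hS : S.Nonempty := by
    refine ⟨∅, ?_⟩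
    simp only [S, Finset.mem_filter_univ]
    intro g hg
    obtain ⟨c, rfl⟩ := C_surjective _ g
    rw [rename_C] at hg
    by_contra hc
    refine this.ne_top (Ideal.eq_top_of_isUnit_mem _ hg ((isUnit_iff_ne_zero.2 fun h ↦ hc ?_).map C))
    simp [h]
  obtain ⟨A, hAmax⟩ := S.exists_maximal hS
  have hA : ∀ g : MvPolynomial A 𝕜, rename (↑) g ∈ p → g = 0 := by simpa [S] using hAmax.1
  have halg : ∀ i ∉ A, ∃ F : Polynomial (MvPolynomial A 𝕜), F ≠ 0 ∧
      F.eval₂ (rename (↑) : MvPolynomial A 𝕜 →ₐ[𝕜] MvPolynomial σ 𝕜).toRingHom (X i) ∈ p := by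
    intro i hi
    have h1 : insert i A ∉ S := fun h ↦
      hi (hAmax.2 h (Finset.subset_insert i A) (Finset.mem_insert_self i A))
    simp only [S, Finset.mem_filter_univ] at h1
    push Not at h1
    obtain ⟨g, hg, hg0⟩ := h1
    exact exists_eval₂_mem_of_not_independent hi hg0 hg
  have hheight : p.height = Nat.card ↥((A : Set σ)ᶜ) :=
    height_eq_card_compl (A := (A : Set σ)) p hA halg
  obtain ⟨A', hcard, hA'⟩ := exists_card_eq_forall_not_support_subset (m := m) this.ne_top A hA
  have hle : m.initialIdeal p ≤ Ideal.span (X '' (A' : Set σ)ᶜ) := by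
    intro f hf
    rw [mem_ideal_span_X_image]
    intro a ha
    obtain ⟨i, hi, hiA⟩ := Finset.not_subset.1 (hA' a (mem_initialIdeal.1 hf a ha))
    exact ⟨i, by simpa using hiA, Finsupp.mem_support_iff.1 hi⟩
  refine (Ideal.height_mono hle).trans ?_
  have h1 := height_span_X_le (𝕜 := 𝕜) A'
  have h2 : Nat.card ↥((A : Set σ)ᶜ) + A'.card = Fintype.card σ := by
    rw [hcard, Nat.card_coe_set_eq, ← Finset.coe_compl, Set.ncard_coe_finset,
      Finset.card_compl_add_card]
  rw [hheight]
  rw [← h2, Nat.cast_add] at h1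
  exact (ENat.add_le_add_iff_right (ENat.natCast_ne_top _)).1 h1

/-- An ideal and its initial ideal have the same height, for every monomial order. -/
theorem height_initialIdeal [Finite σ] (I : Ideal (MvPolynomial σ 𝕜)) :
    (m.initialIdeal I).height = I.height :=
  le_antisymm (height_initialIdeal_le_height I) (height_le_height_initialIdeal I)

end MonomialOrder

/-! ### Diameters of graphs -/

/-- The image of a walk, with repeated vertices collapsed, is a walk that is no longer. -/
theorem SimpleGraph.ediam_le_ediam_of_surjective {V W : Type*} {G : SimpleGraph V}
    {H : SimpleGraph W} (f : V → W) (hf : Function.Surjective f)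
    (h : ∀ u v, G.Adj u v → f u = f v ∨ H.Adj (f u) (f v)) : H.ediam ≤ G.ediam := by
  have hwalk : ∀ u v (w : G.Walk u v), H.edist (f u) (f v) ≤ w.length := by
    intro u v w
    induction w with
    | nil => simp
    | @cons u v x huv w ih =>
      have h1 : H.edist (f u) (f v) ≤ 1 := edist_le_one_iff_adj_or_eq.2 (h u v huv).symm
      rw [Walk.length_cons, Nat.cast_add, Nat.cast_one, add_comm]
      exact H.edist_triangle.trans (add_le_add h1 ih)
  refine ediam_le_of_edist_le fun a b ↦ ?_
  obtain ⟨u, rfl⟩ := hf a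
  obtain ⟨v, rfl⟩ := hf b
  refine le_trans ?_ (edist_le_ediam (G := G) (u := u) (v := v))
  exact le_iInf fun w ↦ hwalk u v w

theorem SimpleGraph.subsingleton_or_exists_adj_of_ediam_ne_top {V : Type*} {G : SimpleGraph V}
    (h : G.ediam ≠ ⊤) (u : V) : Subsingleton V ∨ ∃ v, G.Adj u v := by
  rcases subsingleton_or_nontrivial V with hV | hV
  · exact Or.inl hV
  refine Or.inr ?_
  have : G.Preconnected := fun a b ↦ reachable_of_edist_ne_top fun e ↦
    h (top_le_iff.1 (e ▸ edist_le_ediam))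
  exact this.exists_adj_of_nontrivial u

/-! ### Minimal primes and irredundant decompositions -/

namespace Ideal

variable {R : Type*} [CommRing R] [IsNoetherianRing R]

/-- If the diameter of a radical ideal is finite, then its minimal primes have the same height. -/
theorem height_eq_of_diam_ne_top {I : Ideal R} (hI : I.IsRadical) (h : I.diam ≠ ⊤)
    (P : I.minimalPrimes) : (P : Ideal R).height = I.height := by
  obtain ⟨P, hPmem⟩ := P
  have hP := hPmem.isPrime
  refine le_antisymm ?_ (height_mono hPmem.1.2)
  rcases SimpleGraph.subsingleton_or_exists_adj_of_ediam_ne_top h ⟨P, hPmem⟩ with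
    hs | ⟨⟨Q, hQmem⟩, hne, hQ⟩
  · have h1 : I.minimalPrimes = {P} :=
      Set.eq_singleton_iff_unique_mem.2 ⟨hPmem, fun Q hQ ↦ congrArg Subtype.val
        (Subsingleton.elim (⟨Q, hQ⟩ : I.minimalPrimes) ⟨P, hPmem⟩)⟩
    have h2 : I = P := by
      rw [← hI.radical, ← sInf_minimalPrimes, h1, sInf_singleton]
    exact (congrArg height h2).ge
  -- A neighbour Q gives ht P < ht(P + Q) = ht I + 1.
  · have hlt : P < P ⊔ Q := by
      refine lt_of_le_of_ne le_sup_left fun e ↦ hne (Subtype.ext ?_)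
      have hle : Q ≤ P := e ▸ le_sup_right
      exact le_antisymm (hPmem.2 hQmem.1 hle) hle
    have h1 := height_strict_mono_of_isPrime hlt
    change (P ⊔ Q).height = _ at hQ
    rw [hQ] at h1
    exact (ENat.lt_add_one_iff (height_mono hPmem.1.2 |>.trans_lt height_lt_top_of_isPrime).ne).1 h1

section Decomposition

variable {R : Type*} [CommRing R] {ι : Type*} {p : ι → Ideal R}
  (hprime : ∀ i, (p i).IsPrime)
  (hirredundant : ∀ i, ¬ (⨅ j ∈ {j : ι | j ≠ i}, p j) ≤ p i)

include hirredundant in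
theorem eq_of_le_of_irredundant {i j : ι} (h : p j ≤ p i) : j = i := by
  by_contra hne
  exact hirredundant i ((iInf₂_le j hne).trans h)

include hprime hirredundant in
theorem height_iInf_add_one_le_height_sup [IsNoetherianRing R] {i j : ι} (hij : i ≠ j) :
    (⨅ i, p i).height + 1 ≤ (p i ⊔ p j).height := by
  have := hprime i
  refine (add_le_add_left (height_mono (iInf_le p i)) 1).trans (Order.add_one_le_of_lt ?_)
  refine height_strict_mono_of_isPrime (lt_of_le_of_ne le_sup_left fun e ↦ hij.symm ?_)
  exact eq_of_le_of_irredundant hirredundant (e ▸ le_sup_right)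

variable [Finite ι]

theorem exists_le_of_iInf_le {q : Ideal R} [hq : q.IsPrime] (h : ⨅ i, p i ≤ q) :
    ∃ i, p i ≤ q := by
  have := Fintype.ofFinite ι
  rw [← Finset.inf_univ_eq_iInf, hq.inf_le'] at h
  simpa using h

include hprime in
theorem exists_eq_of_mem_minimalPrimes_iInf {q : Ideal R} (h : q ∈ (⨅ i, p i).minimalPrimes) :
    ∃ i, p i = q := by
  have := h.isPrime
  obtain ⟨i, hi⟩ := exists_le_of_iInf_le h.1.2
  exact ⟨i, le_antisymm hi (h.2 ⟨hprime i, iInf_le p i⟩ hi)⟩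

include hprime hirredundant in
theorem mem_minimalPrimes_iInf_of_irredundant (i : ι) : p i ∈ (⨅ i, p i).minimalPrimes := by
  refine ⟨⟨hprime i, iInf_le p i⟩, fun q ⟨hq, hle⟩ hqi ↦ ?_⟩
  obtain ⟨j, hj⟩ := exists_le_of_iInf_le hle
  rwa [eq_of_le_of_irredundant hirredundant (hj.trans hqi)] at hj

end Decomposition

end Ideal

/-! ### The comparison of diameters -/

theorem theorem3p6 {n s : ℕ} {𝕜 : Type*} [Field 𝕜] (m : MonomialOrder (Fin n))
    (I : Ideal (MvPolynomial (Fin n) 𝕜)) (hI : I.IsRadical)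
    (p : Fin s → Ideal (MvPolynomial (Fin n) 𝕜))
    (hprime : ∀ i, (p i).IsPrime)
    (hdec : I = ⨅ i, p i)
    (hirredundant : ∀ i, ¬ (⨅ j ∈ {j : Fin s | j ≠ i}, p j) ≤ p i)
    (hrad : ∀ A : Set (Fin s), (m.initialIdeal (⨅ i ∈ A, p i)).IsRadical) :
    I.diam ≤ (m.initialIdeal I).diam := by
  by_cases htop : (m.initialIdeal I).diam = ⊤
  · rw [htop]
    exact le_top
  have hIuniv : I = ⨅ i ∈ (Set.univ : Set (Fin s)), p i := by simpa using hdec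
  have hradI : (m.initialIdeal I).IsRadical := hIuniv ▸ hrad Set.univ
  have hheight (P : (m.initialIdeal I).minimalPrimes) :
      (P : Ideal (MvPolynomial (Fin n) 𝕜)).height = I.height := by
    rw [Ideal.height_eq_of_diam_ne_top hradI htop P, MonomialOrder.height_initialIdeal]
  have hsup (i j : Fin s) :
      (m.initialIdeal (p i) ⊔ m.initialIdeal (p j)).height = (p i ⊔ p j).height := by
    have h1 : m.initialIdeal (p i ⊔ p j) = m.initialIdeal (p i) ⊔ m.initialIdeal (p j) := by
      refine le_antisymm (MonomialOrder.initialIdeal_sup_le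
        (MonomialOrder.initialIdeal_inf_le_of_isRadical ?_))
        (sup_le (MonomialOrder.initialIdeal_mono le_sup_left)
          (MonomialOrder.initialIdeal_mono le_sup_right))
      simpa [iInf_or, iInf_inf_eq] using hrad {i, j}
    rw [← h1, MonomialOrder.height_initialIdeal]
  have hlow {i j : Fin s} (hij : i ≠ j) :
      I.height + 1 ≤ (m.initialIdeal (p i) ⊔ m.initialIdeal (p j)).height := by
    rw [hsup, hdec]
    exact Ideal.height_iInf_add_one_le_height_sup hprime hirredundant hij
  -- Equidimensionality of in I makes the component below P unique; surjectivity and the edge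
  -- condition hold for any choice of it.
  have huniq (P : (m.initialIdeal I).minimalPrimes) {i j : Fin s}
      (hi : m.initialIdeal (p i) ≤ P) (hj : m.initialIdeal (p j) ≤ P) : i = j := by
    by_contra hij
    have h1 := (hlow hij).trans (Ideal.height_mono (sup_le hi hj))
    have := P.2.isPrime
    have hfin : (P : Ideal (MvPolynomial (Fin n) 𝕜)).height ≠ ⊤ := Ideal.height_ne_top_of_isPrime
    rw [hheight] at h1 hfin
    exact absurd h1 (not_le.2 ((ENat.lt_add_one_iff' hfin).2 le_rfl))
  have hex (P : (m.initialIdeal I).minimalPrimes) : ∃ i, m.initialIdeal (p i) ≤ P := by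
    have := P.2.isPrime
    have hle : m.initialIdeal (⨅ i ∈ (Set.univ : Set (Fin s)), p i) ≤ P := by
      rw [← hIuniv]
      exact P.2.1.2
    obtain ⟨i, -, hi⟩ := MonomialOrder.exists_initialIdeal_le_of_iInf hle
    exact ⟨i, hi⟩
  choose φ hφ using hex
  have hφsurj : Function.Surjective φ := by
    intro i
    by_contra! hcon
    -- Every P lies above some in p_j with j ≠ i, and in I is the intersection of the P.
    have h1 : m.initialIdeal (⨅ j ∈ {j : Fin s | j ≠ i}, p j) ≤ m.initialIdeal I := by
      refine (le_sInf fun P hP ↦ ?_).trans_eq (Ideal.sInf_minimalPrimes.trans hradI.radical)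
      exact (MonomialOrder.initialIdeal_mono
        (iInf₂_le (f := fun j (_ : j ∈ {j : Fin s | j ≠ i}) ↦ p j) _ (hcon ⟨P, hP⟩))).trans
        (hφ ⟨P, hP⟩)
    have h2 : I ≤ ⨅ j ∈ {j : Fin s | j ≠ i}, p j :=
      hdec ▸ le_iInf₂ fun j _ ↦ iInf_le p j
    refine hirredundant i ?_
    rw [← MonomialOrder.eq_of_le_of_initialIdeal_le h2 h1, hdec]
    exact iInf_le p i
  have hmin (i : Fin s) : p i ∈ I.minimalPrimes :=
    hdec ▸ Ideal.mem_minimalPrimes_iInf_of_irredundant hprime hirredundant i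
  refine SimpleGraph.ediam_le_ediam_of_surjective
    (fun P ↦ (⟨p (φ P), hmin (φ P)⟩ : I.minimalPrimes)) ?_ ?_
  · rintro ⟨q, hq⟩
    obtain ⟨i, rfl⟩ := Ideal.exists_eq_of_mem_minimalPrimes_iInf hprime (hdec ▸ hq)
    obtain ⟨P, rfl⟩ := hφsurj i
    exact ⟨P, rfl⟩
  · rintro P Q ⟨-, hPQ⟩
    by_cases hij : φ P = φ Q
    · exact Or.inl (by simp [hij])
    refine Or.inr ⟨fun e ↦ hij ?_, ?_⟩
    · exact Ideal.eq_of_le_of_irredundant hirredundant (congrArg Subtype.val e).le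
    · change (p (φ P) ⊔ p (φ Q)).height = _
      rw [← hsup]
      -- The upper bound comes from in p_i + in p_j ⊆ P + Q and adjacency of P and Q.
      refine le_antisymm ?_ (hlow hij)
      rw [← MonomialOrder.height_initialIdeal (m := m) I, ← hPQ]
      exact Ideal.height_mono (sup_le_sup (hφ P) (hφ Q))
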